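/- All graphs are finite, simple and undirected, and $d_v$ is the degree of a vertex $v$. A \emph{tree with boundary} is a tree $G=(V,E)$ in which every vertex is either a \emph{boundary vertex} (degree exactly $1$; the set of these is $\partial V$) or an \emph{interior vertex} (degree at least $2$; the set of these is $V_0$), where $V_0$ and $\partial V$ are both non-empty and no edge joins two boundary vertices. Its \emph{discrete Dirichlet operator} is the matrix $\Delta_0=D_0-A_0$ indexed by $V_0$, where $D_0$ is the diagonal matrix of the degrees $d_v$ in $G$ and $A_0$ is the adjacency matrix of the subgraph induced by $V_0$; $\lambda(G)$ denotes its smallest eigenvalue. For a sequence $\pi=(d_0,\dots,d_{n-1})$ of non-negative integers let $\mathcal{T}_\pi$ be the class of all trees with boundary whose $n$ vertices can be numbered so that their degrees are $d_0,\dots,d_{n-1}$. A graph $G$ has the \emph{Faber--Krahn property} in $\mathcal{T}_\pi$ if $G\in\mathcal{T}_\pi$ and $\lambda(G)\le\lambda(H)$ for every $H\in\mathcal{T}_\pi$ (all of which have the same number $n$ of vertices). For a tree with root $v_0$ put $h(v)=\mathrm{dist}(v,v_0)$, and call $w$ a \emph{child} of $v$ if $v,w$ are adjacent and $h(w)=h(v)+1$.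 A tree with boundary $G$ is an \emph{SLO$^*$-tree} if there are a root $v_0\in V$ and a (strict) well-ordering $\prec$ of $V$ such that for all vertices $v,w,v_1,v_2$: (S1) $v\prec w$ implies $h(v)\le h(w)$; (S2) if $v_1\prec v_2$, then $w_1\prec w_2$ for all children $w_1$ of $v_1$ and all children $w_2$ of $v_2$; (S3) if $v\prec w$ and $v\in\partial V$, then $w\in\partial V$; (S4) if $v\prec w$ and $v,w\in V_0$, then $d_v\le d_w$. \textbf{Lemma.} If a tree with boundary $G$ has the Faber--Krahn property in the class $\mathcal{T}_\pi$ for some $\pi$, then $G$ is an SLO$^*$-tree. -/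

import Mathlib

universe u

namespace FaberKrahnTree

open scoped Classical in
/-- The degree of a vertex of a finite simple graph. -/
noncomputable def deg {V : Type u} [Fintype V] (G : SimpleGraph V) (v : V) : ℕ :=
  G.degree v

/-- The set `V₀` of interior vertices: the vertices of degree at least 2. -/
def interiorVertices {V : Type u} [Fintype V] (G : SimpleGraph V) : Set V :=
  {v | 2 ≤ deg G v}

/-- The set `∂V` of boundary vertices: the vertices of degree 1. -/
def boundaryVertices {V : Type u} [Fintype V] (G : SimpleGraph V) : Set V :=
  {v | deg G v = 1}

/-- `G` is a graph with boundary: every vertex is an interior vertex or a boundary vertex,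
there are vertices of both kinds, and no edge joins two boundary vertices. -/
structure IsGraphWithBoundary {V : Type u} [Fintype V] (G : SimpleGraph V) : Prop where
  interior_or_boundary : ∀ v : V, v ∈ interiorVertices G ∨ v ∈ boundaryVertices G
  interior_nonempty : (interiorVertices G).Nonempty
  boundary_nonempty : (boundaryVertices G).Nonempty
  no_boundary_edge : ∀ v ∈ boundaryVertices G, ∀ w ∈ boundaryVertices G, ¬ G.Adj v w

/-- A tree with boundary. -/
def IsTreeWithBoundary {V : Type u} [Fintype V] (G : SimpleGraph V) : Prop :=
  G.IsTree ∧ IsGraphWithBoundary G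

open scoped Classical in
/-- The discrete Dirichlet operator `Δ₀ = D₀ - A₀`, a matrix indexed by the interior vertices:
`D₀` is the diagonal matrix of the degrees in the whole graph, and `A₀` is the adjacency matrix
of the subgraph induced by the interior vertices. -/
noncomputable def dirichletOperator {V : Type u} [Fintype V] (G : SimpleGraph V) :
    Matrix (interiorVertices G) (interiorVertices G) ℝ :=
  Matrix.diagonal (fun v : interiorVertices G => (deg G (v : V) : ℝ)) -
    (G.induce (interiorVertices G)).adjMatrix ℝ

open scoped Classical in
/-- The set of (real) Dirichlet eigenvalues of `G`. -/
def dirichletEigenvalues {V : Type u} [Fintype V] (G : SimpleGraph V) : Set ℝ :=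
  {μ | Module.End.HasEigenvalue (Matrix.toLin' (dirichletOperator G)) μ}

/-- The first (i.e. the smallest) Dirichlet eigenvalue `λ(G)`. -/
noncomputable def firstDirichletEigenvalue {V : Type u} [Fintype V] (G : SimpleGraph V) : ℝ :=
  sInf (dirichletEigenvalues G)

/-- When there is an interior vertex, the infimum above is a minimum. -/
theorem isLeast_firstDirichletEigenvalue {V : Type u} [Fintype V] (G : SimpleGraph V)
    (h : (interiorVertices G).Nonempty) :
    IsLeast (dirichletEigenvalues G) (firstDirichletEigenvalue G) := by
  classical
  have hfin : (dirichletEigenvalues G).Finite :=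
    Module.End.finite_hasEigenvalue (Matrix.toLin' (dirichletOperator G))
  have hH : (dirichletOperator G).IsHermitian := by
    unfold dirichletOperator
    refine Matrix.IsHermitian.sub (by simp [Matrix.IsHermitian]) ?_
    rw [Matrix.IsHermitian, Matrix.conjTranspose_eq_transpose_of_trivial]
    exact SimpleGraph.transpose_adjMatrix _
  have hne : (dirichletEigenvalues G).Nonempty := by
    obtain ⟨v, hv⟩ := h
    refine ⟨hH.eigenvalues ⟨v, hv⟩, ?_⟩
    have := hH.eigenvalues_mem_spectrum_real ⟨v, hv⟩
    rw [← Matrix.spectrum_toLin', ← Module.End.hasEigenvalue_iff_mem_spectrum] at this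
    convert this
  exact ⟨hne.csInf_mem hfin, fun x hx => csInf_le hfin.bddBelow hx⟩

/-- A class of finite graphs. -/
abbrev GraphClass : Type (u + 1) := ∀ (V : Type u) [Fintype V], SimpleGraph V → Prop

/-- `G` has the Faber–Krahn property in the class `C`: it belongs to `C` and has lowest first
Dirichlet eigenvalue among all graphs in `C` with the same volume, i.e. number of vertices. -/
def HasFaberKrahnProperty (C : GraphClass.{u}) {V : Type u} [Fintype V]
    (G : SimpleGraph V) : Prop :=
  C V G ∧ ∀ (W : Type u) [Fintype W] (H : SimpleGraph W), C W H →
    Fintype.card W = Fintype.card V → firstDirichletEigenvalue G ≤ firstDirichletEigenvalue H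

/-- `π = (π 0, …, π (n-1))` is a degree sequence of `G`: for some numbering of the vertices
by `0, …, n-1` the `i`-th vertex has degree `π i`. -/
def HasDegreeSequence {n : ℕ} (π : Fin n → ℕ) {V : Type u} [Fintype V]
    (G : SimpleGraph V) : Prop :=
  ∃ e : Fin n ≃ V, ∀ i, deg G (e i) = π i

/-- The class of all trees with boundary with degree sequence `π`. -/
def treeClass {n : ℕ} (π : Fin n → ℕ) : GraphClass.{u} :=
  fun _ _ G => IsTreeWithBoundary G ∧ HasDegreeSequence π G

/-- The height of the vertex `v` in the tree `G` with root `v₀`. -/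
noncomputable def height {V : Type u} (G : SimpleGraph V) (v₀ v : V) : ℕ :=
  G.dist v v₀

/-- `w` is a child of `v` (and `v` the parent of `w`) in the tree `G` with root `v₀`. -/
def IsChild {V : Type u} (G : SimpleGraph V) (v₀ w v : V) : Prop :=
  G.Adj v w ∧ height G v₀ w = height G v₀ v + 1

/-- The (strict) order `prec` is a spiral-like ordering (SLO-ordering) of the vertices of the
tree with boundary `G` with root `v₀`. -/
structure IsSLOOrdering {V : Type u} [Fintype V] (G : SimpleGraph V) (v₀ : V)
    (prec : V → V → Prop) : Prop where
  isWellOrder : IsWellOrder V prec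
  height_le : ∀ v w, prec v w → height G v₀ v ≤ height G v₀ w
  children : ∀ v₁ v₂, prec v₁ v₂ →
    ∀ w₁ w₂, IsChild G v₀ w₁ v₁ → IsChild G v₀ w₂ v₂ → prec w₁ w₂
  boundary_last : ∀ v w, prec v w → v ∈ boundaryVertices G → w ∈ boundaryVertices G

/-- A spiral-like ordering with increasing degrees (SLO*-ordering). -/
structure IsSLOStarOrdering {V : Type u} [Fintype V] (G : SimpleGraph V) (v₀ : V)
    (prec : V → V → Prop) : Prop extends IsSLOOrdering G v₀ prec where
  degree_le : ∀ v w, v ∈ interiorVertices G → w ∈ interiorVertices G → prec v w →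
    deg G v ≤ deg G w

/-- `G` is an SLO*-tree: a tree with boundary that has an SLO*-ordering for some root. -/
def IsSLOStarTree {V : Type u} [Fintype V] (G : SimpleGraph V) : Prop :=
  IsTreeWithBoundary G ∧ ∃ (v₀ : V) (prec : V → V → Prop), IsSLOStarOrdering G v₀ prec

end FaberKrahnTree

/-! Take a positive first eigenfunction `f` of `G`, extended by zero to the boundary. Let `G'` be a
connected graph on the same vertices, with the same interior and with the degrees permuted. Then
`G'` is again in the class, and `f` is a test function for it. The Faber–Krahn property and the
Rayleigh principle give that the Dirichlet form of `f` on `G'` is at least that on `G`. If it is not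
larger, `f` is also an eigenfunction of `G'` with the same eigenvalue, so the Laplacians of `f` in
`G` and `G'` agree at every interior vertex. This rigidity, recorded in `IsOptimalPair`, turns weak
inequalities into contradictions.

Two rearrangements are used. Replacing the end edges `ab`, `cd` of a path `a b … c d` by `ac`, `bd`
keeps all degrees and changes the form by `2 (f b - f c) (f a - f d)` (`IsOptimalPair.switch`).
Moving `deg v - deg w` children from `v` to `w` swaps the degrees of `v` and `w`
(`IsOptimalPair.shift`).

Root the tree at a maximum of `f` and number it breadth first, siblings by decreasing `f`; (S1) and
(S2) hold by construction. Switching shows that `f` is non-increasing along the numbering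
(`IsOptimalPair.antitone`). Since `f` is positive exactly on the interior, (S3) follows, and
shifting gives (S4) (`IsOptimalPair.deg_le`). -/

namespace FaberKrahnTree

/-! ### Rayleigh principle and positive first eigenfunctions. -/

section Spectral

open scoped Classical in
/-- The neighbours of a vertex, as a finset. -/
noncomputable def nbrs {V : Type u} [Fintype V] (G : SimpleGraph V) (v : V) : Finset V :=
  Finset.univ.filter (G.Adj v)

/-- The Laplacian of the whole graph applied to a function. -/
noncomputable def lap {V : Type u} [Fintype V] (G : SimpleGraph V) (f : V → ℝ) (v : V) : ℝ :=
  ∑ u ∈ nbrs G v, (f v - f u)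

variable {V : Type u} [Fintype V] {G : SimpleGraph V}

@[simp] lemma mem_nbrs {v u : V} : u ∈ nbrs G v ↔ G.Adj v u := by simp [nbrs]

lemma deg_eq_card (G : SimpleGraph V) (v : V) : deg G v = (nbrs G v).card := by
  classical
  unfold deg nbrs
  rw [← SimpleGraph.card_neighborFinset_eq_degree]
  congr 1
  ext u
  simp

lemma lap_eq (G : SimpleGraph V) (f : V → ℝ) (v : V) :
    lap G f v = deg G v * f v - ∑ u ∈ nbrs G v, f u := by
  rw [lap, Finset.sum_sub_distrib, deg_eq_card]
  simp

-- The diagonal carries the degrees in the whole graph and boundary neighbours contribute `0`, so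
-- for functions vanishing off the interior the Dirichlet operator is the full Laplacian.
open scoped Classical in
lemma dirichletOperator_mulVec (f : V → ℝ) (hf : ∀ v, v ∉ interiorVertices G → f v = 0)
    (v : interiorVertices G) :
    (dirichletOperator G).mulVec (fun x => f x) v = lap G f v := by
  classical
  rw [dirichletOperator, Matrix.sub_mulVec, lap_eq, Pi.sub_apply]
  congr 1
  · convert Matrix.mulVec_diagonal _ _ _
  · simp only [Matrix.mulVec, dotProduct, SimpleGraph.adjMatrix_apply, SimpleGraph.comap_adj,
      Function.Embedding.subtype_apply, ite_mul, one_mul, zero_mul, nbrs, Finset.sum_filter]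
    rw [← Finset.sum_subset (Finset.subset_univ
      (Finset.univ.filter (fun x => x ∈ interiorVertices G)))]
    · rw [Finset.sum_subtype (p := fun x => x ∈ interiorVertices G)]
      simp
    · intro x _ hx
      rw [hf x (by simpa using hx)]
      simp

lemma isHermitian_dirichletOperator (G : SimpleGraph V) : (dirichletOperator G).IsHermitian := by
  classical
  unfold dirichletOperator
  refine Matrix.IsHermitian.sub (by simp [Matrix.IsHermitian]) ?_
  rw [Matrix.IsHermitian, Matrix.conjTranspose_eq_transpose_of_trivial]
  exact SimpleGraph.transpose_adjMatrix _

open scoped Classical in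
lemma posSemidef_dirichletOperator_sub (h : (interiorVertices G).Nonempty) :
    (dirichletOperator G - firstDirichletEigenvalue G • 1).PosSemidef := by
  have hH : (dirichletOperator G - firstDirichletEigenvalue G • 1).IsHermitian := by
    refine (isHermitian_dirichletOperator G).sub ?_
    simp [Matrix.IsHermitian]
  rw [hH.posSemidef_iff_eigenvalues_nonneg]
  intro i
  have h1 := hH.mulVec_eigenvectorBasis i
  set x : interiorVertices G → ℝ := ⇑(hH.eigenvectorBasis i)
  have hx : x ≠ 0 := by
    intro h0
    apply hH.eigenvectorBasis.orthonormal.ne_zero i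
    ext j
    exact congrFun h0 j
  have h2 : hH.eigenvalues i + firstDirichletEigenvalue G ∈ dirichletEigenvalues G := by
    refine Module.End.hasEigenvalue_of_hasEigenvector (x := x) ?_
    rw [Module.End.hasEigenvector_iff]
    refine ⟨?_, hx⟩
    rw [Module.End.mem_eigenspace_iff, Matrix.toLin'_apply, add_smul, ← h1, Matrix.sub_mulVec,
      Matrix.smul_mulVec, Matrix.one_mulVec, sub_add_cancel]
  have := (isLeast_firstDirichletEigenvalue G h).2 h2
  simp only [Pi.zero_apply]
  linarith

open scoped Classical in
lemma dotProduct_dirichletOperator (f : V → ℝ) (hf : ∀ v, v ∉ interiorVertices G → f v = 0)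
    (c : ℝ) :
    (fun x : interiorVertices G => f x) ⬝ᵥ
      (dirichletOperator G - c • 1).mulVec (fun x : interiorVertices G => f x) =
    ∑ v, f v * lap G f v - c * ∑ v, f v ^ 2 := by
  classical
  rw [Matrix.sub_mulVec, Matrix.smul_mulVec, Matrix.one_mulVec, dotProduct_sub, dotProduct_smul]
  have key : ∀ g : V → ℝ, ∑ x : interiorVertices G, f x * g x = ∑ v, f v * g v := by
    intro g
    rw [← Finset.sum_subset (Finset.subset_univ
      (Finset.univ.filter (fun x => x ∈ interiorVertices G)))]
    · rw [Finset.sum_subtype (p := fun x => x ∈ interiorVertices G)]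
      simp
    · intro x _ hx
      rw [hf x (by simpa using hx)]
      simp
  congr 1
  · rw [← key, dotProduct]
    refine Finset.sum_congr rfl fun x _ => ?_
    rw [dirichletOperator_mulVec f hf]
  · rw [smul_eq_mul, dotProduct, key]
    simp [sq]

/-- The Rayleigh principle. -/
lemma firstDirichletEigenvalue_mul_le (h : (interiorVertices G).Nonempty) (f : V → ℝ)
    (hf : ∀ v, v ∉ interiorVertices G → f v = 0) :
    firstDirichletEigenvalue G * ∑ v, f v ^ 2 ≤ ∑ v, f v * lap G f v := by
  classical
  have h1 := (posSemidef_dirichletOperator_sub h).dotProduct_mulVec_nonneg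
    (fun x : interiorVertices G => f x)
  have h2 := dotProduct_dirichletOperator f hf (firstDirichletEigenvalue G)
  simp only [star_trivial] at h1
  linarith

/-- The equality case of the Rayleigh principle. -/
lemma lap_eq_of_rayleigh_eq (h : (interiorVertices G).Nonempty) (f : V → ℝ)
    (hf : ∀ v, v ∉ interiorVertices G → f v = 0)
    (he : ∑ v, f v * lap G f v ≤ firstDirichletEigenvalue G * ∑ v, f v ^ 2)
    (v : V) (hv : v ∈ interiorVertices G) :
    lap G f v = firstDirichletEigenvalue G * f v := by
  classical
  have h2 := dotProduct_dirichletOperator f hf (firstDirichletEigenvalue G)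
  have h3 := firstDirichletEigenvalue_mul_le h f hf
  have h1 := ((posSemidef_dirichletOperator_sub h).dotProduct_mulVec_zero_iff
    (fun x : interiorVertices G => f x)).1 (by simp only [star_trivial]; linarith)
  have h4 := congrFun h1 ⟨v, hv⟩
  rw [Matrix.sub_mulVec, Matrix.smul_mulVec, Matrix.one_mulVec, Pi.sub_apply,
    dirichletOperator_mulVec f hf] at h4
  simp only [Pi.smul_apply, smul_eq_mul, Pi.zero_apply] at h4
  linarith

lemma exists_eigenfunction (h : (interiorVertices G).Nonempty) :
    ∃ f : V → ℝ, f ≠ 0 ∧ (∀ v, v ∉ interiorVertices G → f v = 0) ∧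
      ∀ v ∈ interiorVertices G, lap G f v = firstDirichletEigenvalue G * f v := by
  classical
  obtain ⟨x, hx⟩ := (isLeast_firstDirichletEigenvalue G h).1.exists_hasEigenvector
  obtain ⟨hx1, hx2⟩ := Module.End.hasEigenvector_iff.1 hx
  rw [Module.End.mem_eigenspace_iff, Matrix.toLin'_apply] at hx1
  let f : V → ℝ := fun v => if hv : v ∈ interiorVertices G then x ⟨v, hv⟩ else 0
  have hfx : (fun y : interiorVertices G => f y) = x := by
    ext ⟨y, hy⟩
    simp [f, hy]
  have hf : ∀ v, v ∉ interiorVertices G → f v = 0 := fun v hv => by simp [f, hv]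
  refine ⟨f, fun h0 => hx2 ?_, hf, fun v hv => ?_⟩
  · rw [← hfx, h0]
    rfl
  · rw [← dirichletOperator_mulVec f hf ⟨v, hv⟩, hfx, hx1]
    exact congrArg _ (congrFun hfx ⟨v, hv⟩).symm

/-- Symmetrisation over ordered pairs of adjacent vertices; each edge is counted twice, hence the
factor `2`. -/
lemma sum_mul_lap (G : SimpleGraph V) (f : V → ℝ) :
    2 * ∑ v, f v * lap G f v = ∑ v, ∑ u ∈ nbrs G v, (f v - f u) ^ 2 := by
  classical
  have h1 : ∑ v, f v * lap G f v = ∑ v, ∑ u, if G.Adj v u then f v * (f v - f u) else 0 := by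
    refine Finset.sum_congr rfl fun v _ => ?_
    rw [lap, Finset.mul_sum, nbrs, Finset.sum_filter]
  have h2 : ∑ v, f v * lap G f v = ∑ v, ∑ u, if G.Adj v u then f u * (f u - f v) else 0 := by
    rw [h1, Finset.sum_comm]
    simp only [G.adj_comm]
  rw [two_mul]
  nth_rewrite 1 [h1]
  rw [h2, ← Finset.sum_add_distrib]
  refine Finset.sum_congr rfl fun v _ => ?_
  rw [← Finset.sum_add_distrib, nbrs, Finset.sum_filter]
  refine Finset.sum_congr rfl fun u _ => ?_
  split_ifs <;> ring

lemma sum_mul_lap_abs_le (G : SimpleGraph V) (f : V → ℝ) :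
    ∑ v, |f v| * lap G (fun x => |f x|) v ≤ ∑ v, f v * lap G f v := by
  have h1 := sum_mul_lap G f
  have h2 := sum_mul_lap G (fun x => |f x|)
  have h3 : ∑ v, ∑ u ∈ nbrs G v, (|f v| - |f u|) ^ 2 ≤
      ∑ v, ∑ u ∈ nbrs G v, (f v - f u) ^ 2 := by
    refine Finset.sum_le_sum fun v _ => Finset.sum_le_sum fun u _ => ?_
    exact sq_le_sq.2 (abs_abs_sub_abs_le _ _)
  linarith

/-- Zeros of `f` spread along paths when every interior zero forces its neighbours to be zeros. -/
lemma eq_zero_of_walk {f : V → ℝ}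
    (h : ∀ v ∈ interiorVertices G, f v = 0 → ∀ u, G.Adj v u → f u = 0)
    {v w : V} (p : G.Walk v w) (hp : p.IsPath) (hv : v ∈ interiorVertices G) (h0 : f v = 0) :
    f w = 0 := by
  classical
  induction p with
  | nil => exact h0
  | @cons a b c hab q ih =>
    obtain ⟨hq, haq⟩ := (SimpleGraph.Walk.cons_isPath_iff _ _).1 hp
    have hb := h a hv h0 b hab
    by_cases hbi : b ∈ interiorVertices G
    · exact ih hq hbi hb
    -- A non-interior vertex can only end the path: a further step would give `b` the two distinct
    -- neighbours `a` and `d`.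
    · cases q with
      | nil => exact hb
      | @cons _ d _ hbd r =>
        refine absurd ?_ hbi
        change 2 ≤ deg G b
        rw [deg_eq_card]
        have hne : a ≠ d := by
          rintro rfl
          simp at haq
        rw [← Finset.card_pair hne]
        refine Finset.card_le_card ?_
        intro x
        simp only [Finset.mem_insert, Finset.mem_singleton, mem_nbrs]
        rintro (rfl | rfl)
        · exact hab.symm
        · exact hbd

/-- Existence of a positive first eigenfunction. -/
lemma exists_pos_eigenfunction (hc : G.Connected) (h : (interiorVertices G).Nonempty) :
    ∃ f : V → ℝ, (∀ v ∈ interiorVertices G, 0 < f v) ∧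
      (∀ v, v ∉ interiorVertices G → f v = 0) ∧
      ∀ v ∈ interiorVertices G, lap G f v = firstDirichletEigenvalue G * f v := by
  classical
  obtain ⟨f, hf0, hf, hl⟩ := exists_eigenfunction h
  have hg : ∀ v, v ∉ interiorVertices G → |f v| = 0 := fun v hv => by simp [hf v hv]
  have hR : ∑ v, f v * lap G f v = firstDirichletEigenvalue G * ∑ v, f v ^ 2 := by
    rw [Finset.mul_sum]
    refine Finset.sum_congr rfl fun v _ => ?_
    by_cases hv : v ∈ interiorVertices G
    · rw [hl v hv]; ring
    · rw [hf v hv]; ring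
  -- Passing to `|f|` keeps the norm and does not raise the form, so `|f|` is a minimiser and hence
  -- an eigenfunction.
  have hgl := lap_eq_of_rayleigh_eq h (fun x => |f x|) hg (by
    refine (sum_mul_lap_abs_le G f).trans (hR.le.trans ?_)
    simp)
  refine ⟨fun x => |f x|, fun v hv => ?_, hg, hgl⟩
  refine lt_of_le_of_ne (abs_nonneg _) fun h0 => hf0 ?_
  funext w
  obtain ⟨p, hp⟩ := hc.exists_isPath v w
  refine abs_eq_zero.1 (eq_zero_of_walk (f := fun x => |f x|) ?_ p hp hv h0.symm)
  intro x hx hx0 u hxu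
  have h1 := hgl x hx
  rw [lap_eq, hx0] at h1
  simp only [mul_zero, zero_sub, neg_eq_zero] at h1
  exact (Finset.sum_eq_zero_iff_of_nonneg (fun _ _ => abs_nonneg _)).1 h1 u (by simpa using hxu)

/-- The first Dirichlet eigenvalue is positive when there is a boundary. -/
lemma firstDirichletEigenvalue_pos (hG : G.Connected) (hi : (interiorVertices G).Nonempty)
    (hb : (interiorVertices G)ᶜ.Nonempty) {f : V → ℝ}
    (hpos : ∀ v ∈ interiorVertices G, 0 < f v)
    (hf : ∀ v, v ∉ interiorVertices G → f v = 0)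
    (hl : ∀ v ∈ interiorVertices G, lap G f v = firstDirichletEigenvalue G * f v) :
    0 < firstDirichletEigenvalue G := by
  by_contra hle
  -- If the eigenvalue were not positive, the energy would vanish, making `f` constant across edges,
  -- hence zero as it is on the boundary.
  have hR : ∑ v, f v * lap G f v ≤ 0 := by
    refine Finset.sum_nonpos fun v _ => ?_
    by_cases hv : v ∈ interiorVertices G
    · rw [hl v hv]
      nlinarith [mul_pos (hpos v hv) (hpos v hv)]
    · rw [hf v hv]; simp
  have h1 := sum_mul_lap G f
  have h2 : ∑ v, ∑ u ∈ nbrs G v, (f v - f u) ^ 2 = 0 :=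
    le_antisymm (by linarith) (Finset.sum_nonneg fun _ _ => Finset.sum_nonneg fun _ _ => sq_nonneg _)
  have h3 : ∀ v u, G.Adj v u → f v = f u := by
    intro v u huv
    have h4 := (Finset.sum_eq_zero_iff_of_nonneg
      (fun _ _ => Finset.sum_nonneg fun _ _ => sq_nonneg _)).1 h2 v (Finset.mem_univ _)
    have h5 := (Finset.sum_eq_zero_iff_of_nonneg (fun _ _ => sq_nonneg _)).1 h4 u (by simpa)
    exact sub_eq_zero.1 (pow_eq_zero_iff (two_ne_zero)|>.1 h5)
  obtain ⟨v, hv⟩ := hi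
  obtain ⟨w, hw⟩ := hb
  obtain ⟨p⟩ := hG v w
  have h6 : f v = f w := by
    clear hv hw
    induction p with
    | nil => rfl
    | cons h _ ih => exact (h3 _ _ h).trans ih
  have := hpos v hv
  rw [h6, hf w hw] at this
  exact lt_irrefl _ this

end Spectral

/-! ### Moving neighbours from one vertex to another. -/

section Transfer

variable {V : Type u}

/-- The graph obtained from `G` by replacing the edges between `v` and the vertices of `S`
by edges between `w` and the vertices of `S`. -/
def transfer (G : SimpleGraph V) (v w : V) (S : Finset V) (hw : w ∉ S) : SimpleGraph V where
  Adj x y := (G.Adj x y ∧ ¬ (x = v ∧ y ∈ S) ∧ ¬ (y = v ∧ x ∈ S)) ∨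
    (x = w ∧ y ∈ S) ∨ (y = w ∧ x ∈ S)
  symm := ⟨fun x y h => by
    rcases h with ⟨h, h1, h2⟩ | h | h
    · exact Or.inl ⟨h.symm, h2, h1⟩
    · exact Or.inr (Or.inr h)
    · exact Or.inr (Or.inl h)⟩
  loopless := ⟨fun x h => by
    rcases h with ⟨h, -, -⟩ | ⟨rfl, h⟩ | ⟨rfl, h⟩
    · exact h.ne rfl
    · exact hw h
    · exact hw h⟩

variable {G : SimpleGraph V} {v w : V} {S : Finset V} {hw : w ∉ S}

lemma transfer_adj_of_notMem {x y : V} (h : G.Adj x y) (hx : x ∉ S) (hy : y ∉ S) :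
    (transfer G v w S hw).Adj x y :=
  Or.inl ⟨h, fun h => hy h.2, fun h => hx h.2⟩

/-- Walks avoiding the moved vertices survive a transfer. -/
lemma exists_walk_transfer {x y : V} (p : G.Walk x y) (hp : ∀ u ∈ S, u ∉ p.support) :
    ∃ q : (transfer G v w S hw).Walk x y, q.support = p.support := by
  induction p with
  | nil => exact ⟨.nil, rfl⟩
  | cons h q ih =>
    obtain ⟨r, hr⟩ := ih fun u hu hq => hp u hu (by simp [hq])
    refine ⟨.cons (transfer_adj_of_notMem h (fun h1 => hp _ h1 (by simp))
      (fun h1 => hp _ h1 (by simp))) r, by simp [hr]⟩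

/-- The walk `p` survives, so a lost edge from `v` to `u ∈ S` is replaced by the detour along `p` to
`w` and then the new edge to `u`. -/
lemma transfer_connected (hG : G.Connected) (p : G.Walk v w) (hp : ∀ u ∈ S, u ∉ p.support) :
    (transfer G v w S hw).Connected := by
  have := hG.nonempty
  obtain ⟨q, -⟩ := exists_walk_transfer (v := v) (w := w) (hw := hw) p hp
  have hstep : ∀ x y, G.Adj x y → (transfer G v w S hw).Reachable x y := by
    intro x y hxy
    by_cases h1 : x = v ∧ y ∈ S
    · obtain ⟨rfl, hy⟩ := h1
      exact q.reachable.trans (SimpleGraph.Adj.reachable (Or.inr (Or.inl ⟨rfl, hy⟩)))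
    by_cases h2 : y = v ∧ x ∈ S
    · obtain ⟨rfl, hx⟩ := h2
      exact (q.reachable.trans (SimpleGraph.Adj.reachable (Or.inr (Or.inl ⟨rfl, hx⟩)))).symm
    exact SimpleGraph.Adj.reachable (Or.inl ⟨hxy, h1, h2⟩)
  refine ⟨fun x y => ?_⟩
  obtain ⟨r⟩ := hG x y
  induction r with
  | nil => rfl
  | cons h _ ih => exact (hstep _ _ h).trans ih

/-- The hypotheses under which a transfer really moves `S` from `v` to `w`. -/
structure IsTransferable (G : SimpleGraph V) (v w : V) (S : Finset V) : Prop where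
  ne : v ≠ w
  adj : ∀ u ∈ S, G.Adj v u
  not_adj : ∀ u ∈ S, ¬ G.Adj w u

lemma IsTransferable.notMem_left (h : IsTransferable G v w S) : v ∉ S :=
  fun hv => (h.adj v hv).ne rfl

variable [Fintype V]

open scoped Classical in
lemma nbrs_transfer_left (hvw : v ≠ w) (hv : v ∉ S) :
    nbrs (transfer G v w S hw) v = nbrs G v \ S := by
  ext y
  simp only [mem_nbrs, transfer, Finset.mem_sdiff]
  grind

open scoped Classical in
lemma nbrs_transfer_right (hvw : v ≠ w) :
    nbrs (transfer G v w S hw) w = nbrs G w ∪ S := by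
  ext y
  simp only [mem_nbrs, transfer, Finset.mem_union]
  grind

open scoped Classical in
lemma nbrs_transfer_mem (hv : v ∉ S) {u : V} (hu : u ∈ S) :
    nbrs (transfer G v w S hw) u = insert w ((nbrs G u).erase v) := by
  ext y
  simp only [mem_nbrs, transfer, Finset.mem_insert, Finset.mem_erase]
  grind

lemma nbrs_transfer_of_ne {u : V} (huv : u ≠ v) (huw : u ≠ w) (hu : u ∉ S) :
    nbrs (transfer G v w S hw) u = nbrs G u := by
  ext y
  simp only [mem_nbrs, transfer]
  grind

lemma deg_transfer_left (h : IsTransferable G v w S) :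
    deg (transfer G v w S hw) v = deg G v - S.card := by
  classical
  rw [deg_eq_card, nbrs_transfer_left h.ne h.notMem_left, deg_eq_card,
    Finset.card_sdiff_of_subset]
  intro u hu
  simpa using h.adj u hu

lemma deg_transfer_right (h : IsTransferable G v w S) :
    deg (transfer G v w S hw) w = deg G w + S.card := by
  classical
  rw [deg_eq_card, nbrs_transfer_right h.ne, deg_eq_card, Finset.card_union_of_disjoint]
  rw [Finset.disjoint_left]
  intro u hu huS
  exact h.not_adj u huS (by simpa using hu)

lemma deg_transfer_of_ne (h : IsTransferable G v w S) {u : V} (huv : u ≠ v) (huw : u ≠ w) :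
    deg (transfer G v w S hw) u = deg G u := by
  classical
  rw [deg_eq_card, deg_eq_card]
  by_cases hu : u ∈ S
  · rw [nbrs_transfer_mem h.notMem_left hu, Finset.card_insert_of_notMem, Finset.card_erase_of_mem]
    · have : 0 < (nbrs G u).card := Finset.card_pos.2 ⟨v, by simpa using (h.adj u hu).symm⟩
      omega
    · simpa using (h.adj u hu).symm
    · intro hm
      exact h.not_adj u hu ((mem_nbrs.1 (Finset.mem_of_mem_erase hm)).symm)
  · rw [nbrs_transfer_of_ne huv huw hu]

lemma lap_transfer_left (h : IsTransferable G v w S) (f : V → ℝ) :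
    lap (transfer G v w S hw) f v = lap G f v - ∑ u ∈ S, (f v - f u) := by
  classical
  rw [lap, nbrs_transfer_left h.ne h.notMem_left, lap, Finset.sum_sdiff_eq_sub]
  intro u hu
  simpa using h.adj u hu

lemma lap_transfer_right (h : IsTransferable G v w S) (f : V → ℝ) :
    lap (transfer G v w S hw) f w = lap G f w + ∑ u ∈ S, (f w - f u) := by
  classical
  rw [lap, nbrs_transfer_right h.ne, lap, Finset.sum_union]
  rw [Finset.disjoint_left]
  intro u hu huS
  exact h.not_adj u huS (by simpa using hu)

lemma lap_transfer_mem (h : IsTransferable G v w S) (f : V → ℝ) {u : V} (hu : u ∈ S) :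
    lap (transfer G v w S hw) f u = lap G f u + (f v - f w) := by
  classical
  rw [lap, nbrs_transfer_mem h.notMem_left hu, lap, Finset.sum_insert]
  · rw [← Finset.sum_erase_add (nbrs G u) (fun x => f u - f x) (a := v)
      (mem_nbrs.2 (h.adj u hu).symm)]
    ring
  · intro hm
    exact h.not_adj u hu ((mem_nbrs.1 (Finset.mem_of_mem_erase hm)).symm)

lemma lap_transfer_of_ne (f : V → ℝ) {u : V} (huv : u ≠ v) (huw : u ≠ w) (hu : u ∉ S) :
    lap (transfer G v w S hw) f u = lap G f u := by
  rw [lap, nbrs_transfer_of_ne huv huw hu, lap]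

/-- The change of the Dirichlet form under a transfer. -/
lemma sum_mul_lap_transfer (h : IsTransferable G v w S) (f : V → ℝ) :
    ∑ x, f x * lap (transfer G v w S hw) f x =
      ∑ x, f x * lap G f x + ∑ u ∈ S, (f w - f v) * (f w + f v - 2 * f u) := by
  classical
  have key : ∀ x, f x * lap (transfer G v w S hw) f x = f x * lap G f x +
      ((if x = v then -(f v * ∑ u ∈ S, (f v - f u)) else 0) +
      (if x = w then f w * ∑ u ∈ S, (f w - f u) else 0) +
      (if x ∈ S then f x * (f v - f w) else 0)) := by
    intro x
    by_cases hxv : x = v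
    · subst hxv
      rw [lap_transfer_left h, if_pos rfl, if_neg h.ne, if_neg h.notMem_left]
      ring
    by_cases hxw : x = w
    · subst hxw
      rw [lap_transfer_right h, if_pos rfl, if_neg hxv, if_neg hw]
      ring
    by_cases hxS : x ∈ S
    · rw [lap_transfer_mem h f hxS, if_neg hxv, if_neg hxw, if_pos hxS]
      ring
    · rw [lap_transfer_of_ne f hxv hxw hxS, if_neg hxv, if_neg hxw, if_neg hxS]
      ring
  simp only [key, Finset.sum_add_distrib, Finset.sum_ite_eq', Finset.mem_univ, if_true,
    Finset.sum_ite_mem, Finset.univ_inter]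
  rw [← Finset.mul_sum, ← Finset.sum_mul]
  simp only [Finset.sum_sub_distrib, Finset.sum_add_distrib, Finset.sum_const, nsmul_eq_mul,
    ← Finset.mul_sum, mul_sub, mul_add]
  ring

end Transfer

/-! ### Rigidity of optimal trees under rearrangement. -/

section Optimality

variable {V : Type u} [Fintype V] {G : SimpleGraph V}

lemma sum_deg (G : SimpleGraph V) : ∑ v, deg G v = 2 * Nat.card G.edgeSet := by
  classical
  rw [Nat.card_eq_fintype_card, ← SimpleGraph.edgeFinset_card,
    ← SimpleGraph.sum_degrees_eq_twice_card_edges]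
  refine Finset.sum_congr rfl fun v _ => ?_
  unfold deg
  convert rfl

lemma isTree_of_connected_of_deg {G' : SimpleGraph V} (hG : G.IsTree) (hc : G'.Connected)
    (σ : Equiv.Perm V) (hσ : ∀ v, deg G' v = deg G (σ v)) : G'.IsTree := by
  rw [SimpleGraph.isTree_iff_connected_and_card] at hG ⊢
  refine ⟨hc, ?_⟩
  have h1 := sum_deg G
  have h2 := sum_deg G'
  have h3 : ∑ v, deg G' v = ∑ v, deg G v := by
    simp only [hσ]
    exact Equiv.sum_comp σ (deg G)
  omega

/-- Only the absence of boundary edges is not a matter of degrees and edge count: two adjacent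
leaves would form a whole component, yet `G'` is connected and has an interior vertex. -/
lemma isTreeWithBoundary_of_deg {G' : SimpleGraph V} (hG : IsTreeWithBoundary G)
    (hc : G'.Connected) (σ : Equiv.Perm V) (hσ : ∀ v, deg G' v = deg G (σ v)) :
    IsTreeWithBoundary G' := by
  refine ⟨isTree_of_connected_of_deg hG.1 hc σ hσ, ⟨fun v => ?_, ?_, ?_, ?_⟩⟩
  · have := hG.2.interior_or_boundary (σ v)
    simpa only [interiorVertices, boundaryVertices, Set.mem_ofPred_eq, hσ] using this
  · obtain ⟨v, hv⟩ := hG.2.interior_nonempty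
    exact ⟨σ.symm v, by simpa [interiorVertices, hσ] using hv⟩
  · obtain ⟨v, hv⟩ := hG.2.boundary_nonempty
    exact ⟨σ.symm v, by simpa [boundaryVertices, hσ] using hv⟩
  · intro v hv w hw hvw
    obtain ⟨z, hz⟩ := hG.2.interior_nonempty
    have hz' : 2 ≤ deg G' (σ.symm z) := by simpa [interiorVertices, hσ] using hz
    have huniq : ∀ x y, deg G' x = 1 → G'.Adj x y → ∀ t, G'.Adj x t → t = y := by
      intro x y hx hxy t hxt
      rw [deg_eq_card, Finset.card_eq_one] at hx
      obtain ⟨s, hs⟩ := hx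
      have h1 : y ∈ nbrs G' x := by simpa
      have h2 : t ∈ nbrs G' x := by simpa
      rw [hs, Finset.mem_singleton] at h1 h2
      rw [h1, h2]
    have hreach : ∀ t, G'.Reachable v t → t = v ∨ t = w := by
      intro t ⟨p⟩
      have : ∀ {x t : V} (p : G'.Walk x t), (x = v ∨ x = w) → (t = v ∨ t = w) := by
        intro x t p
        induction p with
        | nil => exact id
        | cons h _ ih =>
          rintro (rfl | rfl)
          · exact ih (Or.inr (huniq _ _ hv hvw _ h))
          · exact ih (Or.inl (huniq _ _ hw hvw.symm _ h))
      exact this p (Or.inl rfl)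
    rcases hreach _ (hc v (σ.symm z)) with h | h
    · rw [h, show deg G' v = 1 from hv] at hz'
      omega
    · rw [h, show deg G' w = 1 from hw] at hz'
      omega

/-- A positive first eigenfunction of a tree with boundary that is optimal among the trees
with a given degree sequence. -/
structure IsOptimalPair (G : SimpleGraph V) (f : V → ℝ) : Prop where
  tree : IsTreeWithBoundary G
  pos : ∀ v ∈ interiorVertices G, 0 < f v
  zero : ∀ v, v ∉ interiorVertices G → f v = 0
  lap_pos : ∀ v ∈ interiorVertices G, 0 < lap G f v
  form_le : ∀ G' : SimpleGraph V, G'.Connected → ∀ σ : Equiv.Perm V,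
    (∀ v, deg G' v = deg G (σ v)) → interiorVertices G' = interiorVertices G →
    ∑ v, f v * lap G f v ≤ ∑ v, f v * lap G' f v
  lap_eq : ∀ G' : SimpleGraph V, G'.Connected → ∀ σ : Equiv.Perm V,
    (∀ v, deg G' v = deg G (σ v)) → interiorVertices G' = interiorVertices G →
    ∑ v, f v * lap G' f v ≤ ∑ v, f v * lap G f v →
    ∀ v ∈ interiorVertices G, lap G' f v = lap G f v

lemma exists_isOptimalPair (hG : IsTreeWithBoundary G) {n : ℕ} {π : Fin n → ℕ}
    (hFK : HasFaberKrahnProperty (treeClass.{u} π) G) :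
    ∃ f : V → ℝ, IsOptimalPair G f := by
  obtain ⟨f, hpos, hzero, hl⟩ := exists_pos_eigenfunction hG.1.connected hG.2.interior_nonempty
  have hlam : 0 < firstDirichletEigenvalue G := by
    refine firstDirichletEigenvalue_pos hG.1.connected hG.2.interior_nonempty ?_ hpos hzero hl
    obtain ⟨v, hv⟩ := hG.2.boundary_nonempty
    refine ⟨v, fun h => ?_⟩
    have h1 : 2 ≤ deg G v := h
    have h2 : deg G v = 1 := hv
    omega
  have hR : ∑ v, f v * lap G f v = firstDirichletEigenvalue G * ∑ v, f v ^ 2 := by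
    rw [Finset.mul_sum]
    refine Finset.sum_congr rfl fun v _ => ?_
    by_cases hv : v ∈ interiorVertices G
    · rw [hl v hv]; ring
    · rw [hzero v hv]; ring
  have hmin : ∀ G' : SimpleGraph V, G'.Connected → ∀ σ : Equiv.Perm V,
      (∀ v, deg G' v = deg G (σ v)) →
      firstDirichletEigenvalue G ≤ firstDirichletEigenvalue G' := by
    intro G' hc σ hσ
    refine hFK.2 V G' ⟨isTreeWithBoundary_of_deg hG hc σ hσ, ?_⟩ rfl
    obtain ⟨e, he⟩ := hFK.1.2
    exact ⟨e.trans σ.symm, fun i => by simp [hσ, he]⟩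
  have hS : 0 ≤ ∑ v, f v ^ 2 := Finset.sum_nonneg fun _ _ => sq_nonneg _
  have hS' : 0 < ∑ v, f v ^ 2 := by
    obtain ⟨v, hv⟩ := hG.2.interior_nonempty
    exact Finset.sum_pos' (fun _ _ => sq_nonneg _) ⟨v, Finset.mem_univ _, pow_pos (hpos v hv) 2⟩
  refine ⟨f, hG, hpos, hzero, fun v hv => ?_, ?_, ?_⟩
  · rw [hl v hv]
    exact mul_pos hlam (hpos v hv)
  · intro G' hc σ hσ hi
    rw [hR]
    refine le_trans (mul_le_mul_of_nonneg_right (hmin G' hc σ hσ) hS) ?_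
    exact firstDirichletEigenvalue_mul_le (hi ▸ hG.2.interior_nonempty) f (hi ▸ hzero)
  · intro G' hc σ hσ hi hle v hv
    have h1 := firstDirichletEigenvalue_mul_le (hi ▸ hG.2.interior_nonempty) f (hi ▸ hzero)
    have h2 := hmin G' hc σ hσ
    have h3 : firstDirichletEigenvalue G' = firstDirichletEigenvalue G := by
      refine le_antisymm ?_ h2
      refine le_of_mul_le_mul_right ?_ hS'
      linarith
    rw [lap_eq_of_rayleigh_eq (hi ▸ hG.2.interior_nonempty) f (hi ▸ hzero) (by rw [h3]; linarith)
      v (hi ▸ hv), hl v hv, h3]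

end Optimality

/-! ### Switching the two end edges of a path. -/

section Switching

variable {V : Type u} {G : SimpleGraph V}

/-- The edge `ac` would be a second path from `a` to `c`, besides the one through `b`. -/
lemma not_adj_of_walk (hG : G.IsAcyclic) {a b c : V} (p : G.Walk b c) (ha : a ∉ p.support)
    (hab : G.Adj a b) (hbc : b ≠ c) : ¬ G.Adj a c := by
  classical
  intro hac
  have h1 : (SimpleGraph.Walk.cons hab p.bypass).IsPath :=
    (SimpleGraph.Walk.cons_isPath_iff _ _).2
      ⟨p.bypass_isPath, fun h => ha (p.support_bypass_subset_support h)⟩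
  have h2 : (SimpleGraph.Walk.cons hac SimpleGraph.Walk.nil).IsPath := by
    simp [SimpleGraph.Walk.cons_isPath_iff, hac.ne]
  have h3 := congrArg SimpleGraph.Walk.length
    (congrArg Subtype.val ((hG.subsingleton_path _ _).elim ⟨_, h1⟩ ⟨_, h2⟩))
  simp only [SimpleGraph.Walk.length_cons, SimpleGraph.Walk.length_nil, zero_add,
    Nat.add_eq_right] at h3
  exact hbc (SimpleGraph.Walk.eq_of_length_eq_zero h3)

variable [Fintype V] {f : V → ℝ}

lemma mem_interiorVertices_of_adj {b x y : V} (hx : G.Adj b x) (hy : G.Adj b y) (hxy : x ≠ y) :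
    b ∈ interiorVertices G := by
  classical
  change 2 ≤ deg G b
  rw [deg_eq_card, ← Finset.card_pair hxy]
  refine Finset.card_le_card fun z => ?_
  simp only [Finset.mem_insert, Finset.mem_singleton, mem_nbrs]
  rintro (rfl | rfl)
  exacts [hx, hy]

lemma mem_interiorVertices_of_walk {a b c : V} (p : G.Walk b c) (ha : a ∉ p.support)
    (hab : G.Adj a b) (hbc : b ≠ c) : b ∈ interiorVertices G := by
  cases p with
  | nil => exact absurd rfl hbc
  | cons h q =>
    refine mem_interiorVertices_of_adj hab.symm h ?_
    rintro rfl
    simp at ha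

/-- Switching the edges `ab` and `cd` at the ends of a path `a b … c d` of an optimal tree. -/
lemma IsOptimalPair.switch (hO : IsOptimalPair G f) {a b c d : V} (p : G.Walk b c)
    (ha : a ∉ p.support) (hd : d ∉ p.support) (hab : G.Adj a b) (hcd : G.Adj c d) (hbc : b ≠ c) :
    0 ≤ (f b - f c) * (f a - f d) ∧
      ((f b - f c) * (f a - f d) ≤ 0 → f a = f d ∧ (a ∈ interiorVertices G → f b = f c)) := by
  have hac : ¬ G.Adj a c := not_adj_of_walk hO.tree.1.isAcyclic p ha hab hbc
  have hdb : ¬ G.Adj d b := not_adj_of_walk hO.tree.1.isAcyclic p.reverse (by simpa using hd)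
    hcd.symm hbc.symm
  have had : a ≠ d := by
    rintro rfl
    exact hac hcd.symm
  have hac' : a ≠ c := by
    rintro rfl
    simp at ha
  have hdb' : d ≠ b := by
    rintro rfl
    simp at hd
  have hca : c ∉ ({a} : Finset V) := by simpa using hac'.symm
  have hbd : b ∉ ({d} : Finset V) := by simpa using hdb'.symm
  let G₁ := transfer G b c {a} hca
  have h₁ : IsTransferable G b c {a} :=
    ⟨hbc, by simpa using hab.symm, by simpa using fun h => hac h.symm⟩
  have h₂ : IsTransferable G₁ c b {d} := by
    refine ⟨hbc.symm, ?_, ?_⟩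
    · simp only [Finset.mem_singleton, forall_eq]
      exact transfer_adj_of_notMem hcd hca (by simpa using had.symm)
    · simp only [Finset.mem_singleton, forall_eq]
      rintro (⟨h, -, -⟩ | ⟨h, -⟩ | ⟨h, -⟩)
      · exact hdb h.symm
      · exact hbc h
      · exact hcd.ne h.symm
  let G₂ := transfer G₁ c b {d} hbd
  have hc₁ : G₁.Connected := transfer_connected hO.tree.1.connected p (by simpa using ha)
  obtain ⟨q, hq⟩ := exists_walk_transfer (v := b) (w := c) (hw := hca) p (by simpa using ha)
  have hc₂ : G₂.Connected := transfer_connected hc₁ q.reverse (by simpa [hq] using hd)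
  have hdegb : 0 < deg G b := by
    rw [deg_eq_card]
    exact Finset.card_pos.2 ⟨a, by simpa using hab.symm⟩
  have hdeg : ∀ x, deg G₂ x = deg G x := by
    intro x
    by_cases hxb : x = b
    · subst hxb
      rw [deg_transfer_right h₂, deg_transfer_left h₁]
      simp only [Finset.card_singleton]
      omega
    by_cases hxc : x = c
    · subst hxc
      rw [deg_transfer_left h₂, deg_transfer_right h₁]
      simp
    · rw [deg_transfer_of_ne h₂ hxc hxb, deg_transfer_of_ne h₁ hxb hxc]
  have hint : interiorVertices G₂ = interiorVertices G := by
    ext x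
    simp [interiorVertices, hdeg]
  -- The parts of the two transfer contributions involving only `f b` and `f c` cancel.
  have hform : ∑ x, f x * lap G₂ f x =
      ∑ x, f x * lap G f x + 2 * ((f b - f c) * (f a - f d)) := by
    rw [sum_mul_lap_transfer h₂, sum_mul_lap_transfer h₁, Finset.sum_singleton,
      Finset.sum_singleton]
    ring
  constructor
  · have := hO.form_le G₂ hc₂ (Equiv.refl V) hdeg hint
    linarith
  · intro hle
    have hl := hO.lap_eq G₂ hc₂ (Equiv.refl V) hdeg hint (by linarith)
    constructor
    -- At `b` the neighbour `a` was exchanged for `d`; at `a`, in the other claim, `b` was exchanged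
    -- for `c`.
    · have := hl b (mem_interiorVertices_of_walk p ha hab hbc)
      rw [lap_transfer_right h₂, lap_transfer_left h₁, Finset.sum_singleton,
        Finset.sum_singleton] at this
      linarith
    · intro hai
      have := hl a hai
      rw [lap_transfer_of_ne f hac' hab.ne (by simpa using had),
        lap_transfer_mem h₁ f (by simp)] at this
      linarith

end Switching

/-! ### Monotonicity of the eigenfunction along a breadth-first numbering. -/

section Rooted

/-- `rank` is a breadth-first numbering of the tree `G` with root `v₀` and parent map `par`. -/
structure IsBFSRank {V : Type u} (G : SimpleGraph V) (v₀ : V) (par : V → V) (rank : V → ℕ) :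
    Prop where
  injective : Function.Injective rank
  adj_par : ∀ v, v ≠ v₀ → G.Adj v (par v)
  adj_cases : ∀ v u, G.Adj v u → (v ≠ v₀ ∧ par v = u) ∨ (u ≠ v₀ ∧ par u = v)
  par_lt : ∀ v, v ≠ v₀ → rank (par v) < rank v
  child_lt : ∀ v w, v ≠ v₀ → w ≠ v₀ → rank (par v) < rank (par w) → rank v < rank w

variable {V : Type u} {G : SimpleGraph V} {v₀ : V} {par : V → V} {rank : V → ℕ}

lemma IsBFSRank.par_le (hr : IsBFSRank G v₀ par rank) {v w : V} (hv : v ≠ v₀) (hw : w ≠ v₀)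
    (h : rank v < rank w) : rank (par v) ≤ rank (par w) := by
  by_contra h1
  have := hr.child_lt w v hw hv (by omega)
  omega

/-- The walk from a vertex to the root, with its initial segments. -/
lemma IsBFSRank.exists_walk (hr : IsBFSRank G v₀ par rank) (w : V) :
    ∃ p : G.Walk w v₀, (∀ x ∈ p.support, rank x ≤ rank w) ∧
      ∀ z ∈ p.support, ∃ q : G.Walk w z, ∀ x ∈ q.support, rank x ≤ rank w ∧ rank z ≤ rank x := by
  induction hn : rank w using Nat.strong_induction_on generalizing w with
  | _ n ih =>
    subst hn
    by_cases hw : w = v₀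
    · subst hw
      refine ⟨.nil, by simp, ?_⟩
      intro z hz
      obtain rfl : z = w := by simpa using hz
      exact ⟨.nil, by simp⟩
    · obtain ⟨p, hp, hpz⟩ := ih _ (hr.par_lt w hw) (par w) rfl
      have hlt := hr.par_lt w hw
      refine ⟨.cons (hr.adj_par w hw) p, ?_, ?_⟩
      · intro x hx
        rcases List.mem_cons.1 (by simpa using hx) with rfl | hx
        · exact le_rfl
        · have := hp x hx
          omega
      · intro z hz
        rcases List.mem_cons.1 (by simpa using hz) with rfl | hz
        · exact ⟨.nil, by simp⟩
        · obtain ⟨q, hq⟩ := hpz z hz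
          refine ⟨.cons (hr.adj_par w hw) q, ?_⟩
          intro x hx
          rcases List.mem_cons.1 (by simpa using hx) with rfl | hx
          · have := hp z hz
            exact ⟨le_rfl, by omega⟩
          · have := hq x hx
            exact ⟨by omega, this.2⟩

lemma IsBFSRank.root_le (hr : IsBFSRank G v₀ par rank) (v : V) : rank v₀ ≤ rank v := by
  obtain ⟨p, hp, -⟩ := hr.exists_walk v
  exact hp _ (by simp)

variable [Fintype V] {f : V → ℝ}

lemma IsOptimalPair.nonneg (hO : IsOptimalPair G f) (v : V) : 0 ≤ f v := by
  by_cases hv : v ∈ interiorVertices G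
  · exact (hO.pos v hv).le
  · exact (hO.zero v hv).ge

lemma IsOptimalPair.mem_interior (hO : IsOptimalPair G f) {v : V} (h : 0 < f v) :
    v ∈ interiorVertices G := by
  by_contra hv
  exact h.ne' (hO.zero v hv)

lemma exists_child (hr : IsBFSRank G v₀ par rank) {v : V} (hv : v ∈ interiorVertices G) :
    ∃ x, x ≠ v₀ ∧ par x = v := by
  classical
  have h2 : 1 < (nbrs G v).card := by
    rw [← deg_eq_card]
    exact hv
  obtain ⟨x, hx, hne⟩ := Finset.exists_mem_ne h2 (par v)
  rcases hr.adj_cases v x (by simpa using hx) with h | h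
  · exact absurd h.2.symm hne
  · exact ⟨x, h⟩

/-- In an optimal tree the first eigenfunction decreases along a breadth-first numbering whose
root is a maximum and which numbers siblings by decreasing values. -/
lemma IsOptimalPair.antitone (hO : IsOptimalPair G f) (hr : IsBFSRank G v₀ par rank)
    (hmax : ∀ v, f v ≤ f v₀)
    (hsib : ∀ v w, v ≠ v₀ → w ≠ v₀ → par v = par w → rank v < rank w → f w ≤ f v) :
    ∀ v w, rank v ≤ rank w → f w ≤ f v := by
  intro v
  induction hn : rank v using Nat.strong_induction_on generalizing v with
  | _ n ih =>
    subst hn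
    by_contra! hcon
    obtain ⟨w₁, hw₁, hfw₁⟩ := hcon
    -- Maximality of `f w` is needed when `w` descends from `v`: it bounds `f` at a child of `w`.
    obtain ⟨w, hw, hwmax⟩ := Finset.exists_max_image
      (Finset.univ.filter fun x => rank v ≤ rank x) f ⟨w₁, by simpa using hw₁⟩
    simp only [Finset.mem_filter, Finset.mem_univ, true_and] at hw hwmax
    have hfw : f v < f w := hfw₁.trans_le (hwmax w₁ hw₁)
    have hv : v ≠ v₀ := by
      rintro rfl
      exact absurd (hmax w) (not_le.2 hfw)
    have hvw : rank v < rank w := by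
      refine lt_of_le_of_ne hw fun h => ?_
      rw [hr.injective h] at hfw
      exact lt_irrefl _ hfw
    have hw0 : w ≠ v₀ := by
      rintro rfl
      have := hr.root_le v
      omega
    have hpv := hr.par_lt v hv
    have hpw := hr.par_lt w hw0
    have hne : par v ≠ par w := fun h => absurd (hsib v w hv hw0 h hvw) (not_le.2 hfw)
    have hpp : rank (par v) < rank (par w) :=
      lt_of_le_of_ne (hr.par_le hv hw0 hvw) fun h => hne (hr.injective h)
    have hfp : f (par w) ≤ f (par v) := ih _ hpv (par v) rfl _ hpp.le
    obtain ⟨p₁, hp₁, -⟩ := hr.exists_walk (par v)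
    obtain ⟨p₂, hp₂, hq₂⟩ := hr.exists_walk (par w)
    -- If `w` descends from `v`, the path is `par v, v, …, w, x` with `x` a child of `w`, and `f x ≤
    -- f w ≤ f (par v)`. Otherwise it is `v, par v, …, par w, w`. In both cases the product is
    -- nonpositive, and rigidity forces `f v = f w`.
    by_cases hvp : v ∈ p₂.support
    · obtain ⟨q, hq⟩ : ∃ q : G.Walk w v, ∀ x ∈ q.support, rank x ≤ rank w ∧ rank v ≤ rank x := by
        obtain ⟨q, hq⟩ := hq₂ v hvp
        refine ⟨.cons (hr.adj_par w hw0) q, fun x hx => ?_⟩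
        rcases List.mem_cons.1 (by simpa using hx) with rfl | hx
        · exact ⟨le_rfl, hw⟩
        · have := hq x hx
          omega
      have hfw0 : 0 < f w := (hO.nonneg v).trans_lt hfw
      obtain ⟨x, hx0, hx⟩ := exists_child hr (hO.mem_interior hfw0)
      have hwx := hr.par_lt x hx0
      rw [hx] at hwx
      have hadj := hr.adj_par x hx0
      rw [hx] at hadj
      have hfwp : f w ≤ f (par v) := ih _ hpv (par v) rfl _ (by omega)
      have hfx := hwmax x (by omega)
      have hs := hO.switch q.reverse (a := par v) (d := x)
        (fun h => by have := hq _ (by simpa using h); omega)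
        (fun h => by have := hq _ (by simpa using h); omega)
        (hr.adj_par v hv).symm hadj.symm (fun h => by rw [h] at hvw; exact lt_irrefl _ hvw)
      have h2 := (hs.2 (mul_nonpos_of_nonpos_of_nonneg (by linarith) (by linarith))).2
        (hO.mem_interior (hfw0.trans_le hfwp))
      exact hfw.ne h2
    · have hs := hO.switch (p₁.append p₂.reverse) (a := v) (d := w)
        (fun h => by
          rw [SimpleGraph.Walk.mem_support_append_iff] at h
          rcases h with h | h
          · have := hp₁ _ h
            omega
          · exact hvp (by simpa using h))
        (fun h => by
          rw [SimpleGraph.Walk.mem_support_append_iff] at h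
          rcases h with h | h
          · have := hp₁ _ h
            omega
          · have := hp₂ _ (by simpa using h)
            omega)
        (hr.adj_par v hv) (hr.adj_par w hw0).symm hne
      have h2 := (hs.2 (mul_nonpos_of_nonneg_of_nonpos (by linarith) (by linarith))).1
      exact hfw.ne h2

end Rooted

/-! ### Monotonicity of the interior degrees. -/

section Degrees

variable {V : Type u} [Fintype V] {G : SimpleGraph V} {v₀ : V} {par : V → V} {rank : V → ℕ}
  {f : V → ℝ}

/-- Shifting later children of `v` to `w` in an optimal tree. -/
lemma IsOptimalPair.shift (hO : IsOptimalPair G f) (hr : IsBFSRank G v₀ par rank)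
    (hf : ∀ v w, rank v ≤ rank w → f w ≤ f v) {v w : V} (hv : v ∈ interiorVertices G)
    (hw : w ∈ interiorVertices G) (hvw : rank v < rank w) {S : Finset V}
    (hS : ∀ x ∈ S, x ≠ v₀ ∧ par x = v ∧ rank w < rank x) (hcard : deg G v = deg G w + S.card) :
    ∀ x ∈ S, f x = f v := by
  classical
  have hwS : w ∉ S := fun h => lt_irrefl _ (hS w h).2.2
  have ht : IsTransferable G v w S := by
    refine ⟨fun h => by rw [h] at hvw; exact lt_irrefl _ hvw, fun x hx => ?_, fun x hx h => ?_⟩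
    · have := hr.adj_par x (hS x hx).1
      rw [(hS x hx).2.1] at this
      exact this.symm
    · have h3 := hS x hx
      rcases hr.adj_cases w x h with h4 | h4
      · have := hr.par_lt w h4.1
        rw [h4.2] at this
        omega
      · rw [h3.2.1] at h4
        rw [h4.2] at hvw
        exact lt_irrefl _ hvw
  obtain ⟨p₁, hp₁, -⟩ := hr.exists_walk v
  obtain ⟨p₂, hp₂, -⟩ := hr.exists_walk w
  have hc : (transfer G v w S hwS).Connected := by
    refine transfer_connected hO.tree.1.connected (p₁.append p₂.reverse) fun x hx h => ?_
    have h3 := hS x hx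
    rw [SimpleGraph.Walk.mem_support_append_iff] at h
    rcases h with h | h
    · have := hp₁ _ h
      omega
    · have := hp₂ _ (by simpa using h)
      omega
  have hdeg : ∀ x, deg (transfer G v w S hwS) x = deg G (Equiv.swap v w x) := by
    intro x
    by_cases hxv : x = v
    · subst hxv
      rw [deg_transfer_left ht, Equiv.swap_apply_left]
      omega
    by_cases hxw : x = w
    · subst hxw
      rw [deg_transfer_right ht, Equiv.swap_apply_right, hcard]
    · rw [deg_transfer_of_ne ht hxv hxw, Equiv.swap_apply_of_ne_of_ne hxv hxw]
  have hint : interiorVertices (transfer G v w S hwS) = interiorVertices G := by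
    ext x
    simp only [interiorVertices, Set.mem_ofPred_eq] at hv hw ⊢
    rw [hdeg]
    by_cases hxv : x = v
    · subst hxv
      simp [hv, hw]
    by_cases hxw : x = w
    · subst hxw
      simp [hv, hw]
    · rw [Equiv.swap_apply_of_ne_of_ne hxv hxw]
  have hfvw := hf v w hvw.le
  have hfw : ∀ x ∈ S, f x ≤ f w := fun x hx => hf w x (hS x hx).2.2.le
  have hle : ∑ x, f x * lap (transfer G v w S hwS) f x ≤ ∑ x, f x * lap G f x := by
    rw [sum_mul_lap_transfer ht, add_le_iff_nonpos_right]
    refine Finset.sum_nonpos fun x hx => mul_nonpos_of_nonpos_of_nonneg (by linarith) ?_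
    have := hfw x hx
    linarith
  -- Equality of the Laplacians at `v` makes the sum of `f v - f x` over `S` vanish, and each term
  -- is nonnegative.
  have hl := hO.lap_eq _ hc (Equiv.swap v w) hdeg hint hle v hv
  rw [lap_transfer_left ht, sub_eq_self, Finset.sum_eq_zero_iff_of_nonneg] at hl
  · intro x hx
    have := hl x hx
    linarith
  · intro x hx
    have := hfw x hx
    linarith

/-- If `deg G v > deg G w`, any `deg G v - deg G w` children of `v` other than `w` may be shifted,
so `f` equals `f v` on them. Since the Laplacian at `v` is positive, some neighbour has a smaller
value; it is such a child, and a shifted set can be chosen to contain it. -/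
lemma IsOptimalPair.deg_le_of_consecutive (hO : IsOptimalPair G f)
    (hr : IsBFSRank G v₀ par rank)
    (hf : ∀ v w, rank v ≤ rank w → f w ≤ f v) {v w : V} (hv : v ∈ interiorVertices G)
    (hw : w ∈ interiorVertices G) (hvw : rank v < rank w)
    (hcons : ∀ x, rank v < rank x → rank w ≤ rank x) : deg G v ≤ deg G w := by
  classical
  by_contra! hlt
  have hw2 : 2 ≤ deg G w := hw
  let C := Finset.univ.filter fun x => x ≠ v₀ ∧ par x = v ∧ x ≠ w
  have hC : ∀ x ∈ C, x ≠ v₀ ∧ par x = v ∧ rank w < rank x := by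
    intro x hx
    obtain ⟨h1, h2, h3⟩ : x ≠ v₀ ∧ par x = v ∧ x ≠ w := by simpa [C] using hx
    have h4 := hr.par_lt x h1
    rw [h2] at h4
    exact ⟨h1, h2, lt_of_le_of_ne (hcons x h4) fun h => h3 (hr.injective h).symm⟩
  -- At most `par v` and `w` are excluded from the neighbours of `v`, and `deg G w ≥ 2`.
  have hCcard : deg G v - deg G w ≤ C.card := by
    have h1 : nbrs G v \ {par v, w} ⊆ C := by
      intro x hx
      simp only [Finset.mem_sdiff, mem_nbrs, Finset.mem_insert, Finset.mem_singleton,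
        not_or] at hx
      rcases hr.adj_cases v x hx.1 with h | h
      · exact absurd h.2.symm hx.2.1
      · simp [C, h, hx.2.2]
    have h2 := Finset.card_le_card h1
    have h3 := Finset.le_card_sdiff {par v, w} (nbrs G v)
    have h4 : ({par v, w} : Finset V).card ≤ 2 := Finset.card_le_two
    rw [← deg_eq_card] at h3
    omega
  have hshift : ∀ S ⊆ C, S.card = deg G v - deg G w → ∀ x ∈ S, f x = f v := by
    intro S hSC hS
    exact hO.shift hr hf hv hw hvw (fun x hx => hC x (hSC hx)) (by omega)
  obtain ⟨S, hSC, hS⟩ := Finset.exists_subset_card_eq hCcard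
  obtain ⟨s, hs⟩ : S.Nonempty := Finset.card_pos.1 (by omega)
  have hfw : f v ≤ f w := by
    rw [← hshift S hSC hS s hs]
    exact hf w s (hC s (hSC hs)).2.2.le
  obtain ⟨c, hc, hfc⟩ : ∃ c ∈ nbrs G v, f c < f v := by
    by_contra! h
    refine absurd (hO.lap_pos v hv) (not_lt.2 (Finset.sum_nonpos fun x hx => ?_))
    have := h x hx
    linarith
  have hcC : c ∈ C := by
    rcases hr.adj_cases v c (by simpa using hc) with h | h
    · have := hf (par v) v (hr.par_lt v h.1).le
      rw [h.2] at this
      linarith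
    · have : c ≠ w := by
        rintro rfl
        linarith
      simp [C, h, this]
  obtain ⟨T, hcT, hTC, hT⟩ := Finset.exists_subsuperset_card_eq
    (Finset.singleton_subset_iff.2 hcC) (by simp only [Finset.card_singleton]; omega) hCcard
  exact hfc.ne (hshift T hTC hT c (Finset.singleton_subset_iff.1 hcT))

lemma IsOptimalPair.deg_le (hO : IsOptimalPair G f) (hr : IsBFSRank G v₀ par rank)
    (hf : ∀ v w, rank v ≤ rank w → f w ≤ f v) {v : V} (w : V)
    (hw : w ∈ interiorVertices G) (hvw : rank v < rank w) : deg G v ≤ deg G w := by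
  classical
  induction hn : rank w using Nat.strong_induction_on generalizing w with
  | _ n ih =>
    subst hn
    -- The immediate predecessor of `w`; it is interior because `f z ≥ f w > 0`.
    obtain ⟨z, hz, hzmax⟩ := Finset.exists_max_image
      (Finset.univ.filter fun x => rank x < rank w) rank ⟨v, by simpa using hvw⟩
    simp only [Finset.mem_filter, Finset.mem_univ, true_and] at hz hzmax
    have hzi : z ∈ interiorVertices G :=
      hO.mem_interior ((hO.pos w hw).trans_le (hf z w hz.le))
    have hzw : deg G z ≤ deg G w := by
      refine hO.deg_le_of_consecutive hr hf hzi hw hz fun x hx => ?_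
      by_contra! h
      have := hzmax x h
      omega
    rcases (hzmax v hvw).lt_or_eq with h | h
    · exact (ih _ hz z hzi h rfl).trans hzw
    · rwa [hr.injective h]

end Degrees

/-! ### Construction of the breadth-first numbering. -/

section Numbering

variable {V : Type u} {G : SimpleGraph V}

open scoped Classical in
/-- The parent of a vertex with respect to the root `v₀` (the root is its own parent). -/
noncomputable def parent (G : SimpleGraph V) (v₀ v : V) : V :=
  if h : ∃ u, G.Adj v u ∧ height G v₀ v = height G v₀ u + 1 then h.choose else v

lemma parent_spec (hG : G.Connected) {v₀ v : V} (hv : v ≠ v₀) :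
    G.Adj v (parent G v₀ v) ∧ height G v₀ v = height G v₀ (parent G v₀ v) + 1 := by
  have h : ∃ u, G.Adj v u ∧ height G v₀ v = height G v₀ u + 1 := by
    obtain ⟨p, hp⟩ := hG.exists_walk_length_eq_dist v v₀
    cases p with
    | nil => exact absurd rfl hv
    | @cons _ u _ h q =>
      refine ⟨u, h, ?_⟩
      rw [SimpleGraph.Walk.length_cons] at hp
      have h1 : G.dist u v₀ ≤ q.length := SimpleGraph.dist_le q
      have h2 : G.dist v v₀ ≤ G.dist v u + G.dist u v₀ := hG.dist_triangle
      rw [SimpleGraph.dist_eq_one_iff_adj.2 h] at h2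
      unfold height
      omega
  rw [parent, dif_pos h]
  exact h.choose_spec

/-- Each such neighbour starts a geodesic from `v` to the root, and a tree has only one path between
them. -/
lemma eq_of_height (hG : G.IsTree) {v₀ v u u' : V} (hu : G.Adj v u) (hu' : G.Adj v u')
    (h : height G v₀ v = height G v₀ u + 1) (h' : height G v₀ v = height G v₀ u' + 1) :
    u = u' := by
  have key : ∀ x, G.Adj v x → height G v₀ v = height G v₀ x + 1 →
      ∃ p : G.Walk v v₀, p.IsPath ∧ p.getVert 1 = x := by
    intro x hx hvx
    obtain ⟨p, hp⟩ := hG.connected.exists_walk_length_eq_dist x v₀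
    refine ⟨.cons hx p, SimpleGraph.Walk.isPath_of_length_eq_dist _ ?_, by simp⟩
    rw [SimpleGraph.Walk.length_cons, hp]
    exact hvx.symm
  obtain ⟨p, hp, rfl⟩ := key u hu h
  obtain ⟨q, hq, rfl⟩ := key u' hu' h'
  rw [(hG.existsUnique_path v v₀).unique hp hq]

lemma isChild_iff (hG : G.IsTree) {v₀ v w : V} :
    IsChild G v₀ w v ↔ w ≠ v₀ ∧ parent G v₀ w = v := by
  constructor
  · rintro ⟨h1, h2⟩
    have hw : w ≠ v₀ := by
      rintro rfl
      simp [height] at h2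
    have h3 := parent_spec hG.connected hw
    exact ⟨hw, eq_of_height hG h3.1 h1.symm h3.2 h2⟩
  · rintro ⟨hw, rfl⟩
    have h3 := parent_spec hG.connected hw
    exact ⟨h3.1.symm, h3.2⟩

/-- Breadth-first numbers of the vertices at height `n`, where siblings are ordered by `idx`. -/
noncomputable def bfsKey (G : SimpleGraph V) (v₀ : V) (N : ℕ) (idx : V → ℕ) : ℕ → V → ℕ
  | 0, _ => 1
  | n + 1, v => bfsKey G v₀ N idx n (parent G v₀ v) * N + idx v

/-- The breadth-first number of a vertex. -/
noncomputable def bfsRank (G : SimpleGraph V) (v₀ : V) (N : ℕ) (idx : V → ℕ) (v : V) : ℕ :=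
  bfsKey G v₀ N idx (height G v₀ v) v

variable {v₀ : V} {N : ℕ} {idx : V → ℕ}

lemma bfsRank_root : bfsRank G v₀ N idx v₀ = 1 := by
  simp [bfsRank, height, bfsKey]

lemma bfsRank_of_ne (hG : G.Connected) {v : V} (hv : v ≠ v₀) :
    bfsRank G v₀ N idx v = bfsRank G v₀ N idx (parent G v₀ v) * N + idx v := by
  rw [bfsRank, (parent_spec hG hv).2, bfsKey, bfsRank]

lemma bfsRank_pos (hG : G.Connected) (hN : 2 ≤ N) (v : V) : 0 < bfsRank G v₀ N idx v := by
  induction hn : height G v₀ v using Nat.strong_induction_on generalizing v with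
  | _ n ih =>
    by_cases hv : v = v₀
    · rw [hv, bfsRank_root]
      exact one_pos
    · rw [bfsRank_of_ne hG hv]
      have h1 := ih _ (by have := (parent_spec hG hv).2; omega) (parent G v₀ v) rfl
      have := Nat.mul_pos h1 (show 0 < N by omega)
      omega

/-- Ranks are base-`N` numerals: a child appends the digit `idx < N` to the rank of its parent. The
leading digit `1` at the root makes every rank positive, so appending a digit increases it; the last
digit alone identifies a non-root vertex. -/
lemma isBFSRank_bfsRank (hG : G.IsTree) (hN : 2 ≤ N) (hidx : Function.Injective idx)
    (hlt : ∀ v, idx v < N) : IsBFSRank G v₀ (parent G v₀) (bfsRank G v₀ N idx) := by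
  have hpar : ∀ v, v ≠ v₀ → bfsRank G v₀ N idx (parent G v₀ v) < bfsRank G v₀ N idx v := by
    intro v hv
    rw [bfsRank_of_ne hG.connected hv]
    have h1 := bfsRank_pos (idx := idx) (v₀ := v₀) hG.connected hN (parent G v₀ v)
    nlinarith
  refine ⟨?_, fun v hv => (parent_spec hG.connected hv).1, ?_, hpar, ?_⟩
  · intro v w h
    by_cases hv : v = v₀
    · by_cases hw : w = v₀
      · rw [hv, hw]
      · have h1 := hpar w hw
        rw [← h, hv, bfsRank_root] at h1
        have := bfsRank_pos (idx := idx) (v₀ := v₀) hG.connected hN (parent G v₀ w)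
        omega
    · by_cases hw : w = v₀
      · have h1 := hpar v hv
        rw [h, hw, bfsRank_root] at h1
        have := bfsRank_pos (idx := idx) (v₀ := v₀) hG.connected hN (parent G v₀ v)
        omega
      · rw [bfsRank_of_ne hG.connected hv, bfsRank_of_ne hG.connected hw] at h
        have h2 := congrArg (· % N) h
        simp only [Nat.mul_add_mod_self_right, Nat.mod_eq_of_lt (hlt _)] at h2
        exact hidx h2
  · intro v u huv
    rcases hG.dist_eq_dist_add_one_of_adj v₀ huv with h | h
    · refine Or.inl ((isChild_iff hG).1 ⟨huv.symm, ?_⟩)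
      simpa [height, SimpleGraph.dist_comm] using h
    · refine Or.inr ((isChild_iff hG).1 ⟨huv, ?_⟩)
      simpa [height, SimpleGraph.dist_comm] using h
  · intro v w hv hw h
    rw [bfsRank_of_ne hG.connected hv, bfsRank_of_ne hG.connected hw]
    have := hlt v
    nlinarith

lemma IsBFSRank.height_le (hG : G.Connected) {rank : V → ℕ}
    (hr : IsBFSRank G v₀ (parent G v₀) rank) (v w : V) (h : rank v < rank w) :
    height G v₀ v ≤ height G v₀ w := by
  induction hn : rank w using Nat.strong_induction_on generalizing v w with
  | _ n ih =>
    subst hn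
    by_cases hv : v = v₀
    · simp [hv, height]
    by_cases hw : w = v₀
    · have := hr.root_le v
      rw [← hw] at this
      omega
    rw [(parent_spec hG hv).2, (parent_spec hG hw).2, Nat.add_le_add_iff_right]
    rcases (hr.par_le hv hw h).lt_or_eq with h1 | h1
    · exact ih _ (hr.par_lt w hw) _ _ h1 rfl
    · rw [hr.injective h1]

lemma exists_antitone_index [Fintype V] (f : V → ℝ) :
    ∃ idx : V → ℕ, Function.Injective idx ∧ (∀ v, idx v < Fintype.card V) ∧
      ∀ v w, idx v ≤ idx w → f w ≤ f v := by
  let e := Fintype.equivFin V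
  let g : Fin (Fintype.card V) → ℝ := fun i => - f (e.symm i)
  have hg : Monotone (g ∘ Tuple.sort g) := Tuple.monotone_sort g
  refine ⟨fun v => (Tuple.sort g).symm (e v), ?_, fun v => Fin.is_lt _, fun v w h => ?_⟩
  · intro v w h
    simpa using Fin.val_injective h
  · have := hg (show (Tuple.sort g).symm (e v) ≤ (Tuple.sort g).symm (e w) from h)
    simpa [g] using this

end Numbering

/-- Optimal trees for a given degree sequence are SLO*-trees. -/
theorem isSLOStarTree_of_hasFaberKrahnProperty {V : Type u} [Fintype V] {G : SimpleGraph V}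
    (hG : IsTreeWithBoundary G) {n : ℕ} {π : Fin n → ℕ}
    (hFK : HasFaberKrahnProperty (treeClass.{u} π) G) : IsSLOStarTree G := by
  classical
  obtain ⟨f, hO⟩ := exists_isOptimalPair hG hFK
  obtain ⟨x₀, hx₀⟩ := hG.2.interior_nonempty
  obtain ⟨x₁, hx₁⟩ := hG.2.boundary_nonempty
  have hN : 2 ≤ Fintype.card V := by
    refine Fintype.one_lt_card_iff.2 ⟨x₀, x₁, ?_⟩
    rintro rfl
    have h0 : 2 ≤ deg G x₀ := hx₀
    have h1 : deg G x₀ = 1 := hx₁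
    omega
  obtain ⟨v₀, -, hmax⟩ := Finset.exists_max_image Finset.univ f ⟨x₀, Finset.mem_univ _⟩
  obtain ⟨idx, hinj, hlt, hidx⟩ := exists_antitone_index f
  have hr : IsBFSRank G v₀ (parent G v₀) (bfsRank G v₀ (Fintype.card V) idx) :=
    isBFSRank_bfsRank hG.1 hN hinj hlt
  have hf := hO.antitone hr (fun v => hmax v (Finset.mem_univ _)) (by
    intro v w hv hw hp h
    rw [bfsRank_of_ne hG.1.connected hv, bfsRank_of_ne hG.1.connected hw, hp] at h
    exact hidx v w (by omega))
  set rank := bfsRank G v₀ (Fintype.card V) idx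
  refine ⟨hG, v₀, fun v w => rank v < rank w, ⟨?_, ?_, ?_, ?_⟩, ?_⟩
  · exact { wf := (measure rank).wf
            trichotomous := fun v w h1 h2 => hr.injective (by omega) }
  · exact hr.height_le hG.1.connected
  · intro v₁ v₂ h w₁ w₂ h₁ h₂
    rw [isChild_iff hG.1] at h₁ h₂
    refine hr.child_lt w₁ w₂ h₁.1 h₂.1 ?_
    rwa [h₁.2, h₂.2]
  · intro v w h hv
    rcases hG.2.interior_or_boundary w with hw | hw
    · have h1 := hO.mem_interior ((hO.pos w hw).trans_le (hf v w h.le))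
      have h2 : 2 ≤ deg G v := h1
      have h3 : deg G v = 1 := hv
      omega
    · exact hw
  · intro v w _ hw h
    exact hO.deg_le hr hf w hw h

end FaberKrahnTree

/-- A tree with boundary that has the Faber–Krahn property in some class of all trees with
boundary with a given degree sequence `π` is an SLO*-tree. -/
theorem mainTheorem8 {V : Type u} [Fintype V] (G : SimpleGraph V)
    (hG : FaberKrahnTree.IsTreeWithBoundary G)
    (hFK : ∃ (n : ℕ) (π : Fin n → ℕ),
      FaberKrahnTree.HasFaberKrahnProperty (FaberKrahnTree.treeClass.{u} π) G) :
    FaberKrahnTree.IsSLOStarTree G := by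
  obtain ⟨n, π, h⟩ := hFK
  exact FaberKrahnTree.isSLOStarTree_of_hasFaberKrahnProperty hG h
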